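/- For a sequence $\beta = (\beta_n)_{n\ge 0}$ of positive numbers with $\liminf_{n\to\infty} \beta_n^{1/n} \ge 1$, let $H^2(\beta)$ be the Hilbert space of analytic functions $f(z) = \sum_{n=0}^\infty a_n z^n$ on the open unit disk $\mathbb{D}$ such that $\|f\|^2 := \sum_{n=0}^\infty |a_n|^2 \beta_n < \infty$. A symbol is a non-constant analytic map $\varphi\colon \mathbb{D}\to\mathbb{D}$, and its composition operator is $C_\varphi f = f\circ\varphi$; it is bounded on $H^2(\beta)$ if it maps $H^2(\beta)$ into itself and there is a constant $C$ with $\|C_\varphi f\| \le C\|f\|$ for all $f\in H^2(\beta)$. Theorem. There exist such a sequence $\beta$, namely $\beta_n = e^{\sqrt n}$ for all $n \ge 0$, for which $H^2(\beta)$ is an algebra (under pointwise multiplication), and a symbol $\varphi\in H^2(\beta)$ for which $C_\varphi$ is not bounded on $H^2(\beta)$. -/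

import Mathlib

open Filter Metric

namespace WeightedHardy

/-- An admissible weight: a sequence of positive numbers with `liminf β_n ^ (1/n) ≥ 1`.
The lower limit is taken in `[0, ∞]`, so that it also makes sense for unbounded sequences. -/
structure IsWeight (β : ℕ → ℝ) : Prop where
  pos : ∀ n, 0 < β n
  one_le_liminf : 1 ≤ liminf (fun n : ℕ => ENNReal.ofReal (β n ^ (1 / (n : ℝ)))) atTop

/-- The `n`-th Taylor coefficient of `f` at the origin. -/
noncomputable def taylorCoeff (f : ℂ → ℂ) (n : ℕ) : ℂ :=
  iteratedDeriv n f 0 / (n.factorial : ℂ)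

/-- The weighted Hardy space `H²(β)`: functions analytic in the open unit disk
with `∑ |a_n|² β_n < ∞`. A function on the disk is represented by a function `ℂ → ℂ`, whose
values off the disk play no role. -/
def H2 (β : ℕ → ℝ) : Set (ℂ → ℂ) :=
  {f | DifferentiableOn ℂ f (ball 0 1) ∧ Summable fun n => ‖taylorCoeff f n‖ ^ 2 * β n}

/-- The norm of `H²(β)`, meaningful for `f ∈ H²(β)`. -/
noncomputable def h2Norm (β : ℕ → ℝ) (f : ℂ → ℂ) : ℝ :=
  √(∑' n, ‖taylorCoeff f n‖ ^ 2 * β n)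

/-- `H²(β)` is an algebra: it is a subalgebra for the pointwise operations. -/
def IsAlgebra (β : ℕ → ℝ) : Prop :=
  ∃ A : Subalgebra ℂ (ℂ → ℂ), (A : Set (ℂ → ℂ)) = H2 β

/-- A symbol: a non-constant analytic self-map of the open unit disk. -/
structure IsSymbol (φ : ℂ → ℂ) : Prop where
  analytic : DifferentiableOn ℂ φ (ball 0 1)
  mapsTo : Set.MapsTo φ (ball 0 1) (ball 0 1)
  nonconstant : ¬ ∃ c : ℂ, ∀ z ∈ ball (0 : ℂ) 1, φ z = c

/-- The composition operator `C_φ f = f ∘ φ`. -/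
def compOp (φ f : ℂ → ℂ) : ℂ → ℂ := fun z => f (φ z)

/-- `C_φ` is a bounded operator on `H²(β)`: it maps `H²(β)` into itself, with
`‖C_φ f‖ ≤ C ‖f‖` for some constant `C`. -/
def IsBoundedCompOp (β : ℕ → ℝ) (φ : ℂ → ℂ) : Prop :=
  ∃ C : ℝ, ∀ f ∈ H2 β, compOp φ f ∈ H2 β ∧ h2Norm β (compOp φ f) ≤ C * h2Norm β f

end WeightedHardy

namespace WeightedHardy

section TaylorCoeff

variable {f g : ℂ → ℂ}

/-! Taylor coefficients of a product are convolutions, so Cauchy–Schwarz makes `H2 β` an algebra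
once `∑_{i+j=n} β_i⁻¹ β_j⁻¹ β_n` is bounded in `n` (`mul_mem_H2`). For `β_n = e^{√n}`, concavity of
the root gives `√(i+j) - √i - √j ≤ -min(√i, √j)/2`, so these sums are at most `2 ∑ e^{-√k/2} < ∞`.
Yet `β_{2n}/β_n = e^{(√2-1)√n}` is unbounded, so already the symbol `z²`, which sends `z^n` to
`z^{2n}`, fails to give a bounded operator. -/

theorem contDiffAt_zero_of_differentiableOn (hf : DifferentiableOn ℂ f (ball 0 1))
    (n : WithTop ℕ∞) : ContDiffAt ℂ n f 0 :=
  (hf.analyticAt (ball_mem_nhds 0 one_pos)).contDiffAt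

theorem taylorCoeff_pow (m n : ℕ) :
    taylorCoeff (fun z => z ^ m) n = if n = m then 1 else 0 := by
  unfold taylorCoeff
  rw [iteratedDeriv_fun_pow_zero]
  split_ifs with h
  · subst h
    exact div_self (by exact_mod_cast n.factorial_ne_zero)
  · simp

theorem taylorCoeff_const (c : ℂ) (n : ℕ) :
    taylorCoeff (fun _ => c) n = if n = 0 then c else 0 := by
  unfold taylorCoeff
  rw [iteratedDeriv_const]
  split_ifs with h
  · simp [h]
  · simp

theorem taylorCoeff_add (hf : DifferentiableOn ℂ f (ball 0 1))
    (hg : DifferentiableOn ℂ g (ball 0 1)) (n : ℕ) :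
    taylorCoeff (f + g) n = taylorCoeff f n + taylorCoeff g n := by
  unfold taylorCoeff
  rw [iteratedDeriv_add (contDiffAt_zero_of_differentiableOn hf n)
    (contDiffAt_zero_of_differentiableOn hg n), add_div]

theorem taylorCoeff_mul (hf : DifferentiableOn ℂ f (ball 0 1))
    (hg : DifferentiableOn ℂ g (ball 0 1)) (n : ℕ) :
    taylorCoeff (f * g) n =
      ∑ p ∈ Finset.HasAntidiagonal.antidiagonal n, taylorCoeff f p.1 * taylorCoeff g p.2 := by
  rw [Finset.Nat.sum_antidiagonal_eq_sum_range_succ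
    (fun i j => taylorCoeff f i * taylorCoeff g j)]
  unfold taylorCoeff
  rw [iteratedDeriv_mul (contDiffAt_zero_of_differentiableOn hf n)
    (contDiffAt_zero_of_differentiableOn hg n), Finset.sum_div]
  refine Finset.sum_congr rfl fun i hi => ?_
  have hin : i ≤ n := Nat.lt_succ_iff.mp (Finset.mem_range.mp hi)
  have h1 : (i.factorial : ℂ) ≠ 0 := by exact_mod_cast i.factorial_ne_zero
  have h2 : ((n - i).factorial : ℂ) ≠ 0 := by exact_mod_cast (n - i).factorial_ne_zero
  have h3 : (n.factorial : ℂ) ≠ 0 := by exact_mod_cast n.factorial_ne_zero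
  rw [Nat.cast_choose ℂ hin]
  field_simp

end TaylorCoeff

section Space

variable {β : ℕ → ℝ} {f g : ℂ → ℂ}

theorem const_mem_H2 (β : ℕ → ℝ) (c : ℂ) : (fun _ => c) ∈ H2 β := by
  refine ⟨differentiableOn_const c, summable_of_ne_finset_zero (s := {0}) fun n hn => ?_⟩
  rw [taylorCoeff_const, if_neg (by simpa using hn)]
  simp

theorem pow_mem_H2 (β : ℕ → ℝ) (m : ℕ) : (fun z => z ^ m) ∈ H2 β := by
  refine ⟨(differentiable_id.pow m).differentiableOn,
    summable_of_ne_finset_zero (s := {m}) fun n hn => ?_⟩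
  rw [taylorCoeff_pow, if_neg (by simpa using hn)]
  simp

theorem h2Norm_pow (β : ℕ → ℝ) (m : ℕ) : h2Norm β (fun z => z ^ m) = √(β m) := by
  unfold h2Norm
  rw [tsum_eq_single m fun n hn => by rw [taylorCoeff_pow, if_neg hn]; simp]
  simp [taylorCoeff_pow]

theorem add_mem_H2 (hβ : ∀ n, 0 ≤ β n) (hf : f ∈ H2 β) (hg : g ∈ H2 β) : f + g ∈ H2 β := by
  refine ⟨hf.1.add hg.1, Summable.of_nonneg_of_le (fun n => mul_nonneg (sq_nonneg _) (hβ n))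
    (fun n => ?_) ((hf.2.add hg.2).mul_left 2)⟩
  rw [taylorCoeff_add hf.1 hg.1, ← add_mul, ← mul_assoc]
  refine mul_le_mul_of_nonneg_right ?_ (hβ n)
  exact (pow_le_pow_left₀ (norm_nonneg _) (norm_add_le _ _) 2).trans add_sq_le

/-- If `∑_{i+j=n} β_n / (β_i β_j)` is bounded in `n`, then `H²(β)` is closed under products. -/
theorem mul_mem_H2 (hβ : ∀ n, 0 < β n) {M : ℝ}
    (hM : ∀ n, ∑ p ∈ Finset.HasAntidiagonal.antidiagonal n, β n / (β p.1 * β p.2) ≤ M)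
    (hf : f ∈ H2 β) (hg : g ∈ H2 β) : f * g ∈ H2 β := by
  set u : ℕ → ℝ := fun n => ‖taylorCoeff f n‖ ^ 2 * β n with hu
  set v : ℕ → ℝ := fun n => ‖taylorCoeff g n‖ ^ 2 * β n with hv
  have hu0 : 0 ≤ u := fun n => mul_nonneg (sq_nonneg _) (hβ n).le
  have hv0 : 0 ≤ v := fun n => mul_nonneg (sq_nonneg _) (hβ n).le
  have hsum : Summable fun n => ∑ p ∈ Finset.HasAntidiagonal.antidiagonal n, u p.1 * v p.2 :=
    summable_sum_mul_antidiagonal_of_summable_mul (hf.2.mul_of_nonneg hg.2 hu0 hv0)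
  refine ⟨hf.1.mul hg.1, Summable.of_nonneg_of_le
    (fun n => mul_nonneg (sq_nonneg _) (hβ n).le) (fun n => ?_) (hsum.mul_left M)⟩
  have hnorm : ‖taylorCoeff (f * g) n‖ ≤
      ∑ p ∈ Finset.HasAntidiagonal.antidiagonal n, ‖taylorCoeff f p.1‖ * ‖taylorCoeff g p.2‖ := by
    rw [taylorCoeff_mul hf.1 hg.1]
    exact (norm_sum_le _ _).trans_eq (Finset.sum_congr rfl fun p _ => norm_mul _ _)
  -- Cauchy–Schwarz with each term split as `(β_i β_j)^{-1/2}` times `(u_i v_j)^{1/2}`.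
  have hcs : (∑ p ∈ Finset.HasAntidiagonal.antidiagonal n, ‖taylorCoeff f p.1‖ * ‖taylorCoeff g p.2‖) ^ 2 ≤
      (∑ p ∈ Finset.HasAntidiagonal.antidiagonal n, 1 / (β p.1 * β p.2)) *
        ∑ p ∈ Finset.HasAntidiagonal.antidiagonal n, u p.1 * v p.2 := by
    refine Finset.sum_sq_le_sum_mul_sum_of_sq_le_mul _
      (fun p _ => (one_div_pos.mpr (mul_pos (hβ _) (hβ _))).le)
      (fun p _ => mul_nonneg (hu0 _) (hv0 _)) fun p _ => le_of_eq ?_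
    have h1 := (hβ p.1).ne'
    have h2 := (hβ p.2).ne'
    simp only [hu, hv]
    field_simp
  calc ‖taylorCoeff (f * g) n‖ ^ 2 * β n
      ≤ ((∑ p ∈ Finset.HasAntidiagonal.antidiagonal n, 1 / (β p.1 * β p.2)) *
        ∑ p ∈ Finset.HasAntidiagonal.antidiagonal n, u p.1 * v p.2) * β n :=
        mul_le_mul_of_nonneg_right
          ((pow_le_pow_left₀ (norm_nonneg _) hnorm 2).trans hcs) (hβ n).le
    _ = (∑ p ∈ Finset.HasAntidiagonal.antidiagonal n, β n / (β p.1 * β p.2)) *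
        ∑ p ∈ Finset.HasAntidiagonal.antidiagonal n, u p.1 * v p.2 := by
        rw [mul_right_comm, Finset.sum_mul]
        congr 1
        exact Finset.sum_congr rfl fun p _ => by ring
    _ ≤ M * ∑ p ∈ Finset.HasAntidiagonal.antidiagonal n, u p.1 * v p.2 :=
        mul_le_mul_of_nonneg_right (hM n)
          (Finset.sum_nonneg fun p _ => mul_nonneg (hu0 _) (hv0 _))

theorem isAlgebra_of_sum_div_le (hβ : ∀ n, 0 < β n) {M : ℝ}
    (hM : ∀ n, ∑ p ∈ Finset.HasAntidiagonal.antidiagonal n, β n / (β p.1 * β p.2) ≤ M) : IsAlgebra β :=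
  ⟨{ carrier := H2 β
     mul_mem' := mul_mem_H2 hβ hM
     add_mem' := add_mem_H2 fun n => (hβ n).le
     algebraMap_mem' := const_mem_H2 β }, rfl⟩

end Space

section ExpSqrt

theorem summable_exp_neg_half_sqrt : Summable fun n : ℕ => Real.exp (-(√(n : ℝ) / 2)) := by
  rw [← summable_nat_add_iff 1]
  have h : Summable fun n : ℕ => 384 * (1 / ((n + 1 : ℕ) : ℝ) ^ 2) :=
    ((summable_nat_add_iff 1).mpr (Real.summable_one_div_nat_pow.mpr one_lt_two)).mul_left 384
  refine Summable.of_nonneg_of_le (fun n => (Real.exp_pos _).le) (fun n => ?_) h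
  have hx : (0 : ℝ) < ((n + 1 : ℕ) : ℝ) := by positivity
  -- The fourth-order term of `exp` at `√n/2` is `n²/(16 · 4!)`, whence 384 and comparison with `∑
  -- 1/n²`.
  have h4 := Real.pow_div_factorial_le_exp (√((n + 1 : ℕ) : ℝ) / 2) (by positivity) 4
  have hs : √((n + 1 : ℕ) : ℝ) ^ 4 = ((n + 1 : ℕ) : ℝ) ^ 2 := by
    rw [show (4 : ℕ) = 2 * 2 from rfl, pow_mul, Real.sq_sqrt hx.le]
  rw [div_pow, hs] at h4
  rw [Real.exp_neg, mul_one_div, inv_le_comm₀ (Real.exp_pos _) (by positivity), inv_div]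
  refine le_trans (le_of_eq ?_) h4
  norm_num [Nat.factorial]
  ring

/-- After squaring, the cross term `√x √y` already dominates `y`. -/
theorem sqrt_add_le_add_half {x y : ℝ} (hy : 0 ≤ y) (hyx : y ≤ x) :
    √(x + y) ≤ √x + √y / 2 := by
  have hs : √y ≤ √x := Real.sqrt_le_sqrt hyx
  refine Real.sqrt_le_iff.mpr ⟨by positivity, ?_⟩
  nlinarith [Real.sq_sqrt hy, Real.sq_sqrt (hy.trans hyx),
    mul_le_mul_of_nonneg_left hs (Real.sqrt_nonneg y)]

theorem exp_sqrt_add_div_le (i j : ℕ) :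
    Real.exp √((i + j : ℕ) : ℝ) / (Real.exp √(i : ℝ) * Real.exp √(j : ℝ)) ≤
      Real.exp (-(√(i : ℝ) / 2)) + Real.exp (-(√(j : ℝ) / 2)) := by
  rw [← Real.exp_add, ← Real.exp_sub, Nat.cast_add]
  rcases le_total j i with h | h
  · have := sqrt_add_le_add_half (Nat.cast_nonneg (α := ℝ) j) (Nat.cast_le.mpr h)
    exact (Real.exp_le_exp.mpr (by linarith)).trans
      (le_add_of_nonneg_left (Real.exp_pos _).le)
  · have := sqrt_add_le_add_half (Nat.cast_nonneg (α := ℝ) i) (Nat.cast_le.mpr h)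
    rw [add_comm (j : ℝ)] at this
    exact (Real.exp_le_exp.mpr (by linarith)).trans
      (le_add_of_nonneg_right (Real.exp_pos _).le)

theorem sum_exp_sqrt_div_le (n : ℕ) :
    ∑ p ∈ Finset.HasAntidiagonal.antidiagonal n,
        Real.exp √(n : ℝ) / (Real.exp √(p.1 : ℝ) * Real.exp √(p.2 : ℝ)) ≤
      2 * ∑' k : ℕ, Real.exp (-(√(k : ℝ) / 2)) := by
  have hle : ∑ k ∈ Finset.range n.succ, Real.exp (-(√(k : ℝ) / 2)) ≤
      ∑' k : ℕ, Real.exp (-(√(k : ℝ) / 2)) :=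
    summable_exp_neg_half_sqrt.sum_le_tsum _ fun k _ => (Real.exp_pos _).le
  have hfst := Finset.Nat.sum_antidiagonal_eq_sum_range_succ
    (fun i _ => Real.exp (-(√(i : ℝ) / 2))) n
  have hsnd := Finset.Nat.sum_antidiagonal_swap (n := n)
    (f := fun p : ℕ × ℕ => Real.exp (-(√(p.1 : ℝ) / 2)))
  calc _ ≤ ∑ p ∈ Finset.HasAntidiagonal.antidiagonal n,
        (Real.exp (-(√(p.1 : ℝ) / 2)) + Real.exp (-(√(p.2 : ℝ) / 2))) := by
        refine Finset.sum_le_sum fun p hp => ?_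
        rw [← Finset.HasAntidiagonal.mem_antidiagonal.mp hp]
        exact exp_sqrt_add_div_le p.1 p.2
    _ = 2 * ∑ k ∈ Finset.range n.succ, Real.exp (-(√(k : ℝ) / 2)) := by
        rw [Finset.sum_add_distrib, two_mul, ← hfst]
        exact congrArg _ hsnd
    _ ≤ _ := by linarith

theorem isWeight_exp_sqrt : IsWeight fun n : ℕ => Real.exp √(n : ℝ) where
  pos _ := Real.exp_pos _
  one_le_liminf := le_liminf_of_le (h := Eventually.of_forall fun n =>
    ENNReal.one_le_ofReal.mpr (Real.one_le_rpow
      (Real.one_le_exp (Real.sqrt_nonneg _)) (by positivity)))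

theorem isAlgebra_exp_sqrt : IsAlgebra fun n : ℕ => Real.exp √(n : ℝ) :=
  isAlgebra_of_sum_div_le (fun _ => Real.exp_pos _) sum_exp_sqrt_div_le

end ExpSqrt

theorem isSymbol_sq : IsSymbol fun z => z ^ 2 where
  analytic := (differentiable_id.pow 2).differentiableOn
  mapsTo z hz := by
    rw [mem_ball_zero_iff] at hz ⊢
    rw [norm_pow]
    exact pow_lt_one₀ (norm_nonneg z) hz two_ne_zero
  nonconstant := by
    rintro ⟨c, hc⟩
    have h0 := hc 0 (by simp)
    have h1 := hc (1 / 2) (by rw [mem_ball_zero_iff]; norm_num)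
    rw [← h0] at h1
    norm_num at h1

/-- Composition with `z ^ 2` maps `z ^ n` to `z ^ (2 n)`, and `exp (√(2 n) - √n)` is unbounded. -/
theorem not_isBoundedCompOp_sq :
    ¬ IsBoundedCompOp (fun n : ℕ => Real.exp √(n : ℝ)) fun z => z ^ 2 := by
  rintro ⟨C, hC⟩
  obtain ⟨m, hm⟩ := exists_nat_gt C
  -- With `n = (6m)²`, `√n = 6m` and `√(2n) = √72 m ≥ 8m`; norms carry half these exponents, so
  -- their ratio is at least `e^{4m-3m} = e^m > m > C`.
  have h := (hC _ (pow_mem_H2 _ ((6 * m) ^ 2))).2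
  have hcomp : compOp (fun z => z ^ 2) (fun z => z ^ ((6 * m) ^ 2)) =
      fun z => z ^ (2 * (6 * m) ^ 2) := by
    funext z
    exact (pow_mul z 2 _).symm
  rw [hcomp, h2Norm_pow, h2Norm_pow, ← Real.exp_half, ← Real.exp_half] at h
  have hm0 : (0 : ℝ) ≤ m := Nat.cast_nonneg m
  have hsq : √(((6 * m) ^ 2 : ℕ) : ℝ) = 6 * m := by
    push_cast
    exact Real.sqrt_sq (by positivity)
  have hsq2 : 8 * (m : ℝ) ≤ √((2 * (6 * m) ^ 2 : ℕ) : ℝ) := by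
    refine Real.le_sqrt_of_sq_le ?_
    push_cast
    nlinarith [sq_nonneg (m : ℝ)]
  rw [hsq] at h
  have hexp : Real.exp m * Real.exp (6 * m / 2) ≤ C * Real.exp (6 * m / 2) := by
    rw [← Real.exp_add]
    exact (Real.exp_le_exp.mpr (by linarith)).trans h
  have := le_of_mul_le_mul_right hexp (Real.exp_pos _)
  linarith [Real.add_one_le_exp (m : ℝ)]

end WeightedHardy

theorem mainTheorem11 :
    ∃ β : ℕ → ℝ, (∀ n : ℕ, β n = Real.exp (√(n : ℝ))) ∧
      WeightedHardy.IsWeight β ∧ WeightedHardy.IsAlgebra β ∧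
      ∃ φ : ℂ → ℂ, WeightedHardy.IsSymbol φ ∧ φ ∈ WeightedHardy.H2 β ∧
        ¬ WeightedHardy.IsBoundedCompOp β φ :=
  ⟨fun n => Real.exp √(n : ℝ), fun _ => rfl, WeightedHardy.isWeight_exp_sqrt,
    WeightedHardy.isAlgebra_exp_sqrt, fun z => z ^ 2, WeightedHardy.isSymbol_sq,
    WeightedHardy.pow_mem_H2 _ 2, WeightedHardy.not_isBoundedCompOp_sq⟩
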